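/- Let $A\in\mathbb{R}^{n\times n}$, $B\in\mathbb{R}^{n\times m}$, $G\in\mathbb{R}^{n\times q}$, and let $Q\succeq 0$ and $P_f\succeq 0$ (both $n\times n$) and $R\succ 0$ ($m\times m$) be real symmetric matrices such that $\mathcal{R}(G)\subseteq\mathcal{R}(B)$ and $G'P_fG\neq 0$. Let $\|\cdot\|$ denote the induced two-norm of a matrix. For a horizon $N\ge 1$ and a scalar $\lambda$ define, backwards from $\Pi_N(\lambda)=P_f$, for $k=N-1,\dots,0$, $$\Pi_k(\lambda)=Q+A'\Pi_{k+1}A-A'\Pi_{k+1}\begin{bmatrix}B&G\end{bmatrix}\begin{bmatrix}B'\Pi_{k+1}B+R & B'\Pi_{k+1}G\\ (B'\Pi_{k+1}G)' & G'\Pi_{k+1}G-\lambda I\end{bmatrix}^{-1}\begin{bmatrix}B'\\G'\end{bmatrix}\Pi_{k+1}A,\qquad \Pi_{k+1}=\Pi_{k+1}(\lambda).$$ Define the multiplier bounds by $\lambda_N=\|G'P_fG\|$ and, for $k=N-1,\dots,1$, $$\lambda_k=\begin{cases}\min\{\lambda\ge\lambda_{k+1}:\ \lambda=\|G'\Pi_k(\lambda)G\|\}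 & \text{if } \|G'\Pi_k(\lambda_{k+1})G\|>\lambda_{k+1},\\ \lambda_{k+1} & \text{otherwise.}\end{cases}$$ For $\alpha>0$ let $\mathcal{X}_L(\alpha,N)\subseteq\mathbb{R}^n$ be the set of all $x_0$ for which $\lambda=\lambda_1$ is optimal in $$\min_{\lambda\in[\lambda_1,\infty)}\ \frac12\Bigl(\frac{x_0}{\sqrt\alpha}\Bigr)'\Pi_0(\lambda)\Bigl(\frac{x_0}{\sqrt\alpha}\Bigr)+\frac{\lambda}{2},$$ and put $\mathcal{X}_L^\infty(\alpha)=\bigcap_{N=1}^\infty\mathcal{X}_L(\alpha,N)$ and $\mathcal{X}_{NL}^\infty(\alpha)=\mathbb{R}^n\setminus\mathcal{X}_L^\infty(\alpha)$. Then, for every $\alpha>0$, the set $\mathcal{X}_L^\infty(\alpha)$ contains $0$ (in particular it is nonempty), is closed and is convex; hence $\mathcal{X}_{NL}^\infty(\alpha)$ is open. -/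

import Mathlib

noncomputable section

namespace SiDAR

/-- The data of the regulation problem: dynamics `x⁺ = A x + B u + G w` with state in `ℝⁿ`,
control in `ℝᵐ` and disturbance in `ℝ^q`, stage cost `(1/2) x'Qx + (1/2) u'Ru` and terminal cost
`(1/2) x' Pf x`. The assumptions on the data are hypotheses of the theorem. -/
structure Plant (n m q : ℕ) where
  A : Matrix (Fin n) (Fin n) ℝ
  B : Matrix (Fin n) (Fin m) ℝ
  G : Matrix (Fin n) (Fin q) ℝ
  Q : Matrix (Fin n) (Fin n) ℝ
  R : Matrix (Fin m) (Fin m) ℝ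
  Pf : Matrix (Fin n) (Fin n) ℝ

/-- The induced two-norm of a square real matrix. -/
def twoNorm {q : ℕ} (M : Matrix (Fin q) (Fin q) ℝ) : ℝ :=
  ‖Matrix.toEuclideanCLM (n := Fin q) (𝕜 := ℝ) M‖

variable {n m q : ℕ}

/-- The block matrix `M(lam, P) = [B'PB + R, B'PG; (B'PG)', G'PG - lam I]`. -/
def blockM (S : Plant n m q) (lam : ℝ) (P : Matrix (Fin n) (Fin n) ℝ) :
    Matrix (Fin m ⊕ Fin q) (Fin m ⊕ Fin q) ℝ :=
  Matrix.fromBlocks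
    (S.B.transpose * P * S.B + S.R) (S.B.transpose * P * S.G)
    (S.B.transpose * P * S.G).transpose (S.G.transpose * P * S.G - lam • 1)

/-- One backward step `P ↦ Q + A'PA - A'P [B G] M(lam, P)⁻¹ [B'; G'] P A` of the Riccati
recursion. -/
def riccatiStep (S : Plant n m q) (lam : ℝ) (P : Matrix (Fin n) (Fin n) ℝ) :
    Matrix (Fin n) (Fin n) ℝ :=
  S.Q + S.A.transpose * P * S.A
    - S.A.transpose * P * Matrix.fromCols S.B S.G * (blockM S lam P)⁻¹
      * Matrix.fromRows S.B.transpose S.G.transpose * P * S.A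

/-- The value matrix with `j` stages to go: `P_0 = Pf` and `P_{j+1} = riccatiStep P_j`. -/
def valueToGo (S : Plant n m q) (lam : ℝ) : ℕ → Matrix (Fin n) (Fin n) ℝ
  | 0 => S.Pf
  | j + 1 => riccatiStep S lam (valueToGo S lam j)

/-- The stage matrix `Π_k(lam)` for horizon `N` (`k ≤ N`), so that `Π_N = Pf`. -/
def stagePi (S : Plant n m q) (N k : ℕ) (lam : ℝ) : Matrix (Fin n) (Fin n) ℝ :=
  valueToGo S lam (N - k)

/-- The multiplier lower bound with `j` stages to go: it starts at `‖G' Pf G‖`, and it is raised to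
the least `lam` above the previous bound with `lam = ‖G' P_{j+1}(lam) G‖` whenever
`‖G' P_{j+1} G‖` exceeds the previous bound at that bound. -/
def boundToGo (S : Plant n m q) : ℕ → ℝ
  | 0 => twoNorm (S.G.transpose * S.Pf * S.G)
  | j + 1 =>
    open Classical in
    if boundToGo S j
        < twoNorm (S.G.transpose * valueToGo S (boundToGo S j) (j + 1) * S.G) then
      sInf {lam : ℝ | boundToGo S j ≤ lam ∧
        lam = twoNorm (S.G.transpose * valueToGo S lam (j + 1) * S.G)}
    else boundToGo S j

/-- The multiplier lower bound `λ_k` for horizon `N` (`1 ≤ k ≤ N`), so that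
`λ_N = ‖G' Π_N G‖` and `λ_k` enforces `λ ≥ ‖G' Π_i(λ) G‖` for `i = k, …, N`. -/
def stageBound (S : Plant n m q) (N k : ℕ) : ℝ := boundToGo S (N - k)

/-- The objective `(1/2) (x₀/√α)' Π_0(lam) (x₀/√α) + lam/2` of the scalar problem for horizon
`N`. -/
def objective (S : Plant n m q) (α : ℝ) (N : ℕ) (x₀ : Fin n → ℝ) (lam : ℝ) : ℝ :=
  (1 / 2) * (((Real.sqrt α)⁻¹ • x₀) ⬝ᵥ
    Matrix.mulVec (stagePi S N 0 lam) ((Real.sqrt α)⁻¹ • x₀)) + lam / 2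

/-- The linear region for horizon `N`: the initial states for which `λ_1` is optimal in the
minimization of the objective over `[λ_1, ∞)`. -/
def regionL (S : Plant n m q) (α : ℝ) (N : ℕ) : Set (Fin n → ℝ) :=
  {x₀ | IsMinOn (objective S α N x₀) (Set.Ici (stageBound S N 1)) (stageBound S N 1)}

/-- The limit linear region, the intersection of the linear regions over all horizons `N ≥ 1`. -/
def limitRegionL (S : Plant n m q) (α : ℝ) : Set (Fin n → ℝ) :=
  ⋂ (N : ℕ) (_ : 1 ≤ N), regionL S α N

/-- The limit nonlinear region, the complement of the limit linear region. -/
def limitRegionNL (S : Plant n m q) (α : ℝ) : Set (Fin n → ℝ) :=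
  (limitRegionL S α)ᶜ

end SiDAR

end

/-!
One Riccati step is the value of a zero-sum game: completing the square in the stage cost shows
that `x'Π_k(λ)x` is its saddle value as long as `G'Π_{k+1}(λ)G ≼ λI`, where the inclusion
`R(G) ⊆ R(B)` keeps the block matrix invertible up to the threshold `λ = ‖G'Π_{k+1}(λ)G‖`. The
stage cost decreases when `λ` grows or when the terminal weight shrinks, hence so does its saddle
value, and backward induction makes every `Π_k(λ)` antitone in `λ` for the Loewner order.
Therefore `λ₁` is optimal at `x₀` iff `x₀' (Π₀(λ₁) - Π₀(λ)) x₀ ≤ α (λ - λ₁)` for all `λ ≥ λ₁`: the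
linear region is an intersection of closed convex sublevel sets of positive semidefinite forms.
-/

namespace SiDAR

open Matrix Set
open scoped MatrixOrder

/-! ### Quadratic forms and the Loewner order -/

section QuadraticForm

variable {ι κ l R : Type*}

lemma isSymm_of_nonneg {M : Matrix ι ι ℝ} (hM : 0 ≤ M) : M.IsSymm :=
  isHermitian_iff_isSymm.mp (nonneg_iff_posSemidef.mp hM).isHermitian

variable [Fintype ι]

lemma dotProduct_transpose_mul_mul_mulVec [CommSemiring R] [Fintype κ] [Fintype l]
    (C : Matrix ι κ R) (P : Matrix ι ι R) (D : Matrix ι l R) (u : κ → R) (v : l → R) :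
    u ⬝ᵥ (Cᵀ * P * D) *ᵥ v = (C *ᵥ u) ⬝ᵥ P *ᵥ (D *ᵥ v) := by
  rw [← mulVec_mulVec, ← mulVec_mulVec, dotProduct_mulVec, vecMul_transpose]

lemma dotProduct_mulVec_comm [CommSemiring R] {M : Matrix ι ι R} (hM : M.IsSymm) (a b : ι → R) :
    a ⬝ᵥ M *ᵥ b = b ⬝ᵥ M *ᵥ a := by
  rw [dotProduct_mulVec, ← mulVec_transpose, hM.eq, dotProduct_comm]

lemma dotProduct_mulVec_add_add [CommSemiring R] {M : Matrix ι ι R} (hM : M.IsSymm)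
    (a b : ι → R) :
    (a + b) ⬝ᵥ M *ᵥ (a + b) = a ⬝ᵥ M *ᵥ a + 2 * (a ⬝ᵥ M *ᵥ b) + b ⬝ᵥ M *ᵥ b := by
  rw [mulVec_add, add_dotProduct, dotProduct_add, dotProduct_add, dotProduct_mulVec_comm hM b a]
  ring

lemma dotProduct_mulVec_add_two_mul_dotProduct [CommRing R] [DecidableEq ι] {M : Matrix ι ι R}
    (hM : M.IsSymm) (hdet : IsUnit M.det) (c z : ι → R) :
    z ⬝ᵥ M *ᵥ z + 2 * (z ⬝ᵥ c) =
      (z + M⁻¹ *ᵥ c) ⬝ᵥ M *ᵥ (z + M⁻¹ *ᵥ c) - c ⬝ᵥ M⁻¹ *ᵥ c := by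
  have hMc : M *ᵥ (M⁻¹ *ᵥ c) = c := by rw [mulVec_mulVec, mul_nonsing_inv _ hdet, one_mulVec]
  rw [dotProduct_mulVec_add_add hM, hMc, dotProduct_comm c]
  ring

lemma dotProduct_mulVec_nonneg {M : Matrix ι ι ℝ} (hM : 0 ≤ M) (x : ι → ℝ) :
    0 ≤ x ⬝ᵥ M *ᵥ x :=
  (nonneg_iff_posSemidef.mp hM).dotProduct_mulVec_nonneg x

lemma dotProduct_mulVec_mono {M M' : Matrix ι ι ℝ} (h : M ≤ M') (x : ι → ℝ) :
    x ⬝ᵥ M *ᵥ x ≤ x ⬝ᵥ M' *ᵥ x := by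
  simpa [sub_mulVec] using dotProduct_mulVec_nonneg (sub_nonneg.mpr h) x

lemma le_of_dotProduct_mulVec_le {M M' : Matrix ι ι ℝ} (hM : M.IsSymm) (hM' : M'.IsSymm)
    (h : ∀ x, x ⬝ᵥ M *ᵥ x ≤ x ⬝ᵥ M' *ᵥ x) : M ≤ M' :=
  le_iff.mpr <| .of_dotProduct_mulVec_nonneg (isHermitian_iff_isSymm.mpr (hM'.sub hM)) fun x => by
    simpa [sub_mulVec] using h x

lemma transpose_mul_mul_mono [Finite κ] {M M' : Matrix ι ι ℝ} (h : M ≤ M') (C : Matrix ι κ ℝ) :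
    Cᵀ * M * C ≤ Cᵀ * M' * C := by
  rw [le_iff] at h ⊢
  simpa [Matrix.mul_sub, Matrix.sub_mul] using h.conjTranspose_mul_mul_same C

lemma transpose_mul_mul_nonneg [Finite κ] {M : Matrix ι ι ℝ} (hM : 0 ≤ M) (C : Matrix ι κ ℝ) :
    0 ≤ Cᵀ * M * C := by
  simpa using transpose_mul_mul_mono hM C

lemma dotProduct_mulVec_le_of_transpose_mul_mul_le [Fintype κ] [DecidableEq κ]
    {M : Matrix ι ι ℝ} {C : Matrix ι κ ℝ} {c : ℝ} (h : Cᵀ * M * C ≤ c • 1) (w : κ → ℝ) :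
    (C *ᵥ w) ⬝ᵥ M *ᵥ (C *ᵥ w) ≤ c * (w ⬝ᵥ w) := by
  simpa only [dotProduct_transpose_mul_mul_mulVec, smul_mulVec, one_mulVec, dotProduct_smul,
    smul_eq_mul] using dotProduct_mulVec_mono h w

lemma convexOn_dotProduct_mulVec {M : Matrix ι ι ℝ} (hM : 0 ≤ M) :
    ConvexOn ℝ univ fun x : ι → ℝ => x ⬝ᵥ M *ᵥ x := by
  refine ⟨convex_univ, fun x _ y _ a b ha hb hab => ?_⟩
  have hxy := dotProduct_mulVec_comm (isSymm_of_nonneg hM) x y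
  have hgap : a * (x ⬝ᵥ M *ᵥ x) + b * (y ⬝ᵥ M *ᵥ y)
      - (a • x + b • y) ⬝ᵥ M *ᵥ (a • x + b • y) = a * b * ((x - y) ⬝ᵥ M *ᵥ (x - y)) := by
    obtain rfl : b = 1 - a := by linarith
    simp only [mulVec_add, mulVec_sub, mulVec_smul, dotProduct_add, dotProduct_sub,
      add_dotProduct, sub_dotProduct, dotProduct_smul, smul_dotProduct, smul_eq_mul, hxy]
    ring
  have := mul_nonneg (mul_nonneg ha hb) (dotProduct_mulVec_nonneg hM (x - y))
  simp only [smul_eq_mul]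
  linarith

end QuadraticForm

variable {n m q : ℕ}

/-! ### The induced two-norm -/

lemma continuous_twoNorm : Continuous (twoNorm (q := q)) :=
  (toEuclideanCLM (n := Fin q) (𝕜 := ℝ)).toAlgEquiv.toLinearMap.continuous_of_finiteDimensional.norm

lemma twoNorm_pos {X : Matrix (Fin q) (Fin q) ℝ} (hX : X ≠ 0) : 0 < twoNorm X :=
  norm_pos_iff.mpr <|
    (map_ne_zero_iff _ (toEuclideanCLM (n := Fin q) (𝕜 := ℝ)).injective).mpr hX

lemma rayleighQuotient_toEuclideanCLM (X : Matrix (Fin q) (Fin q) ℝ)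
    (v : EuclideanSpace ℝ (Fin q)) :
    (toEuclideanCLM (n := Fin q) (𝕜 := ℝ) X).rayleighQuotient v
      = (v ⬝ᵥ X *ᵥ v) / (v ⬝ᵥ v) := by
  have hv : v ⬝ᵥ v = ‖v‖ ^ 2 := by
    rw [EuclideanSpace.real_norm_sq_eq]
    simp only [dotProduct, sq]
  rw [hv, ContinuousLinearMap.rayleighQuotient, ContinuousLinearMap.reApplyInnerSelf_apply,
    real_inner_comm, inner_toEuclideanCLM]
  rfl

lemma twoNorm_le_iff {X : Matrix (Fin q) (Fin q) ℝ} (hX : 0 ≤ X) {c : ℝ} (hc : 0 ≤ c) :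
    twoNorm X ≤ c ↔ X ≤ c • 1 := by
  have hsymm : (toEuclideanCLM (n := Fin q) (𝕜 := ℝ) X).IsSymmetric :=
    isSymmetric_toEuclideanLin_iff.mpr (nonneg_iff_posSemidef.mp hX).isHermitian
  have hself (w : Fin q → ℝ) : 0 ≤ w ⬝ᵥ w := by simpa using dotProduct_star_self_nonneg w
  constructor
  · intro h
    refine le_of_dotProduct_mulVec_le (isSymm_of_nonneg hX) (isSymm_one.smul c) fun w => ?_
    have hw := (le_abs_self _).trans (((toEuclideanCLM (n := Fin q) (𝕜 := ℝ)
      X).rayleighQuotient_le_norm (WithLp.toLp 2 w)).trans h)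
    rw [rayleighQuotient_toEuclideanCLM] at hw
    rcases (hself w).eq_or_lt with h0 | hpos
    · simp [dotProduct_self_eq_zero.mp h0.symm]
    · simpa [smul_mulVec] using (div_le_iff₀ hpos).mp hw
  · intro h
    rw [twoNorm, ContinuousLinearMap.norm_eq_iSup_rayleighQuotient _ hsymm]
    refine ciSup_le fun v => ?_
    rw [rayleighQuotient_toEuclideanCLM,
      abs_of_nonneg (div_nonneg (dotProduct_mulVec_nonneg hX _) (hself _))]
    refine div_le_of_le_mul₀ (hself _) hc ?_
    simpa [smul_mulVec] using dotProduct_mulVec_mono h v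

lemma twoNorm_mono {X Y : Matrix (Fin q) (Fin q) ℝ} (hX : 0 ≤ X) (hXY : X ≤ Y) :
    twoNorm X ≤ twoNorm Y :=
  (twoNorm_le_iff hX (norm_nonneg _)).mpr <|
    hXY.trans ((twoNorm_le_iff (hX.trans hXY) (norm_nonneg _)).mp le_rfl)

/-! ### The saddle point of one stage -/

section Stage

variable {S : Plant n m q} {lam mu : ℝ} {P P' : Matrix (Fin n) (Fin n) ℝ}

lemma isSymm_blockM (hR : S.R.IsSymm) (hP : P.IsSymm) : (blockM S lam P).IsSymm := by
  simp [IsSymm, blockM, fromBlocks_transpose, hP.eq, hR.eq, Matrix.mul_assoc]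

lemma isSymm_riccatiStep (hQ : S.Q.IsSymm) (hR : S.R.IsSymm) (hP : P.IsSymm) :
    (riccatiStep S lam P).IsSymm := by
  simp [IsSymm, riccatiStep, transpose_nonsing_inv, (isSymm_blockM hR hP).eq, hP.eq, hQ.eq,
    Matrix.mul_assoc, transpose_fromCols, transpose_fromRows]

lemma dotProduct_blockM_mulVec (hP : P.IsSymm) (u u' : Fin m → ℝ) (w w' : Fin q → ℝ) :
    Sum.elim u w ⬝ᵥ blockM S lam P *ᵥ Sum.elim u' w' =
      u ⬝ᵥ S.R *ᵥ u' + (S.B *ᵥ u + S.G *ᵥ w) ⬝ᵥ P *ᵥ (S.B *ᵥ u' + S.G *ᵥ w')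
        - lam * (w ⬝ᵥ w') := by
  have hBG : (S.Bᵀ * P * S.G)ᵀ = S.Gᵀ * P * S.B := by simp [hP.eq, Matrix.mul_assoc]
  rw [blockM, hBG, fromBlocks_mulVec, sumElim_dotProduct_sumElim]
  simp only [add_mulVec, sub_mulVec, smul_mulVec, one_mulVec, dotProduct_add, dotProduct_sub,
    dotProduct_smul, smul_eq_mul, dotProduct_transpose_mul_mul_mulVec, Sum.elim_comp_inl,
    Sum.elim_comp_inr, mulVec_add, add_dotProduct]
  ring

/-- If `(u, w)` is in the kernel, testing against `(u, -w)` forces `u = 0`; testing against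
`(v, -w)` with `Bv = Gw` cancels the weight `P` and forces `w = 0`. -/
lemma isUnit_det_blockM (hR : S.R.PosDef)
    (hrange : LinearMap.range S.G.mulVecLin ≤ LinearMap.range S.B.mulVecLin)
    (hlam : 0 < lam) (hP : 0 ≤ P) (hPG : S.Gᵀ * P * S.G ≤ lam • 1) :
    IsUnit (blockM S lam P).det := by
  rw [isUnit_iff_ne_zero]
  intro hdet
  obtain ⟨z, hz, hMz⟩ := exists_mulVec_eq_zero_iff.mpr hdet
  obtain ⟨u, w, rfl⟩ : ∃ u w, z = Sum.elim u w := ⟨_, _, (Sum.elim_comp_inl_inr z).symm⟩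
  have hkernel (v : Fin m → ℝ) : v ⬝ᵥ S.R *ᵥ u
      + (S.B *ᵥ v - S.G *ᵥ w) ⬝ᵥ P *ᵥ (S.B *ᵥ u + S.G *ᵥ w) + lam * (w ⬝ᵥ w) = 0 := by
    have h := dotProduct_blockM_mulVec (S := S) (lam := lam) (isSymm_of_nonneg hP) v u (-w) w
    rw [hMz, dotProduct_zero, mulVec_neg, neg_dotProduct] at h
    rw [sub_eq_add_neg]
    linarith
  have hu : u = 0 := by
    by_contra hu
    have huR : 0 < u ⬝ᵥ S.R *ᵥ u := hR.dotProduct_mulVec_pos hu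
    have hBu := dotProduct_mulVec_nonneg hP (S.B *ᵥ u)
    have hGw := dotProduct_mulVec_le_of_transpose_mul_mul_le hPG w
    have h := hkernel u
    rw [sub_dotProduct, mulVec_add, dotProduct_add, dotProduct_add,
      dotProduct_mulVec_comm (isSymm_of_nonneg hP) (S.G *ᵥ w) (S.B *ᵥ u)] at h
    linarith
  have hw : w = 0 := by
    obtain ⟨v, hv⟩ := hrange ⟨w, rfl⟩
    have hv' : S.B *ᵥ v = S.G *ᵥ w := hv
    simpa [hu, hv', hlam.ne', dotProduct_self_eq_zero] using hkernel v
  exact hz (by simp [hu, hw])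

/-- Twice the cost of one stage at state `x` under control `u` and disturbance `w`, with terminal
weight `P` and penalty `lam` on the disturbance. -/
def stageCost (S : Plant n m q) (lam : ℝ) (P : Matrix (Fin n) (Fin n) ℝ)
    (x : Fin n → ℝ) (u : Fin m → ℝ) (w : Fin q → ℝ) : ℝ :=
  x ⬝ᵥ S.Q *ᵥ x + u ⬝ᵥ S.R *ᵥ u
    + (S.A *ᵥ x + (S.B *ᵥ u + S.G *ᵥ w)) ⬝ᵥ P *ᵥ (S.A *ᵥ x + (S.B *ᵥ u + S.G *ᵥ w))
    - lam * (w ⬝ᵥ w)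

/-- The stationary point `(u, w)` of the stage cost at state `x`, stacked into one vector. -/
noncomputable def stageSaddle (S : Plant n m q) (lam : ℝ) (P : Matrix (Fin n) (Fin n) ℝ)
    (x : Fin n → ℝ) : Fin m ⊕ Fin q → ℝ :=
  -((blockM S lam P)⁻¹ *ᵥ fromRows S.Bᵀ S.Gᵀ *ᵥ P *ᵥ S.A *ᵥ x)

lemma dotProduct_riccatiStep_mulVec (hP : P.IsSymm) (x : Fin n → ℝ) :
    x ⬝ᵥ riccatiStep S lam P *ᵥ x =
      x ⬝ᵥ S.Q *ᵥ x + (S.A *ᵥ x) ⬝ᵥ P *ᵥ (S.A *ᵥ x)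
        - (fromRows S.Bᵀ S.Gᵀ *ᵥ P *ᵥ S.A *ᵥ x) ⬝ᵥ
          (blockM S lam P)⁻¹ *ᵥ (fromRows S.Bᵀ S.Gᵀ *ᵥ P *ᵥ S.A *ᵥ x) := by
  have hfactor : S.Aᵀ * P * fromCols S.B S.G = (fromRows S.Bᵀ S.Gᵀ * P * S.A)ᵀ := by
    simp [transpose_fromRows, hP.eq, Matrix.mul_assoc]
  have hassoc : S.Aᵀ * P * fromCols S.B S.G * (blockM S lam P)⁻¹ * fromRows S.Bᵀ S.Gᵀ * P * S.A
      = (fromRows S.Bᵀ S.Gᵀ * P * S.A)ᵀ * (blockM S lam P)⁻¹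
        * (fromRows S.Bᵀ S.Gᵀ * P * S.A) := by
    rw [hfactor]
    simp only [Matrix.mul_assoc]
  rw [riccatiStep, hassoc, sub_mulVec, add_mulVec, dotProduct_sub, dotProduct_add,
    dotProduct_transpose_mul_mul_mulVec, dotProduct_transpose_mul_mul_mulVec]
  simp only [mulVec_mulVec, Matrix.mul_assoc]

lemma stageCost_eq_riccatiStep_add (hR : S.R.IsSymm) (hP : P.IsSymm)
    (hM : IsUnit (blockM S lam P).det) (x : Fin n → ℝ) (u : Fin m → ℝ) (w : Fin q → ℝ) :
    stageCost S lam P x u w =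
      x ⬝ᵥ riccatiStep S lam P *ᵥ x
        + (Sum.elim u w - stageSaddle S lam P x) ⬝ᵥ
          blockM S lam P *ᵥ (Sum.elim u w - stageSaddle S lam P x) := by
  have hlin : Sum.elim u w ⬝ᵥ fromRows S.Bᵀ S.Gᵀ *ᵥ P *ᵥ S.A *ᵥ x =
      (S.A *ᵥ x) ⬝ᵥ P *ᵥ (S.B *ᵥ u + S.G *ᵥ w) := by
    rw [dotProduct_mulVec_comm hP, fromRows_mulVec, sumElim_dotProduct_sumElim,
      dotProduct_mulVec u, dotProduct_mulVec w, vecMul_transpose, vecMul_transpose,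
      add_dotProduct]
  have hsquare := dotProduct_mulVec_add_two_mul_dotProduct (isSymm_blockM hR hP) hM
    (fromRows S.Bᵀ S.Gᵀ *ᵥ P *ᵥ S.A *ᵥ x) (Sum.elim u w)
  rw [dotProduct_blockM_mulVec hP, hlin] at hsquare
  rw [stageCost, dotProduct_mulVec_add_add hP, dotProduct_riccatiStep_mulVec hP, stageSaddle,
    sub_neg_eq_add]
  linarith

lemma stageCost_saddle_control_le (hR : S.R.IsSymm) (hP : P.IsSymm)
    (hM : IsUnit (blockM S lam P).det) (hPG : S.Gᵀ * P * S.G ≤ lam • 1)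
    (x : Fin n → ℝ) (w : Fin q → ℝ) :
    stageCost S lam P x (stageSaddle S lam P x ∘ Sum.inl) w ≤ x ⬝ᵥ riccatiStep S lam P *ᵥ x := by
  have hsub : Sum.elim (stageSaddle S lam P x ∘ Sum.inl) w - stageSaddle S lam P x
      = Sum.elim (0 : Fin m → ℝ) (w - stageSaddle S lam P x ∘ Sum.inr) := by
    ext (i | i) <;> simp
  rw [stageCost_eq_riccatiStep_add hR hP hM, hsub, dotProduct_blockM_mulVec hP]
  simpa only [mulVec_zero, zero_add, zero_dotProduct, add_le_iff_nonpos_right, sub_nonpos]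
    using dotProduct_mulVec_le_of_transpose_mul_mul_le hPG _

lemma le_stageCost_saddle_disturbance (hR : 0 ≤ S.R) (hP : 0 ≤ P)
    (hM : IsUnit (blockM S lam P).det) (x : Fin n → ℝ) (u : Fin m → ℝ) :
    x ⬝ᵥ riccatiStep S lam P *ᵥ x ≤ stageCost S lam P x u (stageSaddle S lam P x ∘ Sum.inr) := by
  have hsub : Sum.elim u (stageSaddle S lam P x ∘ Sum.inr) - stageSaddle S lam P x
      = Sum.elim (u - stageSaddle S lam P x ∘ Sum.inl) (0 : Fin q → ℝ) := by
    ext (i | i) <;> simp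
  rw [stageCost_eq_riccatiStep_add (isSymm_of_nonneg hR) (isSymm_of_nonneg hP) hM, hsub,
    dotProduct_blockM_mulVec (isSymm_of_nonneg hP)]
  simpa only [mulVec_zero, add_zero, dotProduct_zero, mul_zero, sub_zero, le_add_iff_nonneg_right]
    using add_nonneg (dotProduct_mulVec_nonneg hR _) (dotProduct_mulVec_nonneg hP _)

lemma stageCost_mono (hle : lam ≤ mu) (hP : P' ≤ P) (x : Fin n → ℝ) (u : Fin m → ℝ)
    (w : Fin q → ℝ) : stageCost S mu P' x u w ≤ stageCost S lam P x u w := by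
  have hw : 0 ≤ w ⬝ᵥ w := by simpa using dotProduct_star_self_nonneg w
  have := dotProduct_mulVec_mono hP (S.A *ᵥ x + (S.B *ᵥ u + S.G *ᵥ w))
  unfold stageCost
  gcongr

lemma riccatiStep_mono (hQ : S.Q.IsSymm) (hR : S.R.PosDef)
    (hrange : LinearMap.range S.G.mulVecLin ≤ LinearMap.range S.B.mulVecLin)
    (hlam : 0 < lam) (hle : lam ≤ mu) (hP' : 0 ≤ P') (hP'P : P' ≤ P)
    (hPG : S.Gᵀ * P * S.G ≤ lam • 1) :
    riccatiStep S mu P' ≤ riccatiStep S lam P := by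
  have hP : 0 ≤ P := hP'.trans hP'P
  have hP'G : S.Gᵀ * P' * S.G ≤ mu • 1 :=
    calc S.Gᵀ * P' * S.G ≤ S.Gᵀ * P * S.G := transpose_mul_mul_mono hP'P S.G
      _ ≤ lam • 1 := hPG
      _ ≤ mu • 1 := smul_le_smul_of_nonneg_right hle (nonneg_iff_posSemidef.mpr .one)
  have hM := isUnit_det_blockM hR hrange hlam hP hPG
  have hM' := isUnit_det_blockM hR hrange (hlam.trans_le hle) hP' hP'G
  have hR₀ : 0 ≤ S.R := nonneg_iff_posSemidef.mpr hR.posSemidef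
  have hRs := isSymm_of_nonneg hR₀
  refine le_of_dotProduct_mulVec_le (isSymm_riccatiStep hQ hRs (isSymm_of_nonneg hP'))
    (isSymm_riccatiStep hQ hRs (isSymm_of_nonneg hP)) fun x => ?_
  set u := stageSaddle S lam P x ∘ Sum.inl
  set w := stageSaddle S mu P' x ∘ Sum.inr
  calc x ⬝ᵥ riccatiStep S mu P' *ᵥ x
      ≤ stageCost S mu P' x u w := le_stageCost_saddle_disturbance hR₀ hP' hM' x u
    _ ≤ stageCost S lam P x u w := stageCost_mono hle hP'P x u w
    _ ≤ x ⬝ᵥ riccatiStep S lam P *ᵥ x :=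
      stageCost_saddle_control_le hRs (isSymm_of_nonneg hP) hM hPG x w

lemma riccatiStep_nonneg (hQ : 0 ≤ S.Q) (hR : S.R.PosDef)
    (hrange : LinearMap.range S.G.mulVecLin ≤ LinearMap.range S.B.mulVecLin)
    (hlam : 0 < lam) (hP : 0 ≤ P) (hPG : S.Gᵀ * P * S.G ≤ lam • 1) :
    0 ≤ riccatiStep S lam P :=
  calc 0 ≤ S.Q := hQ
    _ = riccatiStep S lam 0 := by simp [riccatiStep]
    _ ≤ riccatiStep S lam P :=
      riccatiStep_mono (isSymm_of_nonneg hQ) hR hrange hlam le_rfl le_rfl hP hPG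

lemma continuous_riccatiStep {X : Type*} [TopologicalSpace X] {lam : X → ℝ}
    {P : X → Matrix (Fin n) (Fin n) ℝ} (hlam : Continuous lam) (hP : Continuous P)
    (hM : ∀ x, IsUnit (blockM S (lam x) (P x)).det) :
    Continuous fun x => riccatiStep S (lam x) (P x) := by
  have hblock : Continuous fun x => blockM S (lam x) (P x) :=
    .matrix_fromBlocks (by fun_prop) (by fun_prop) (by fun_prop) (by fun_prop)
  have hinv : Continuous fun x => (blockM S (lam x) (P x))⁻¹ := by
    refine continuous_iff_continuousAt.mpr fun x => ?_
    refine (continuousAt_matrix_inv _ ?_).comp hblock.continuousAt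
    rw [Ring.inverse_eq_inv']
    exact continuousAt_inv₀ (hM x).ne_zero
  unfold riccatiStep
  fun_prop

end Stage

/-! ### Monotonicity in the multiplier -/

/-- A continuous family of positive semidefinite matrices that decreases in the Loewner order as
the multiplier ranges over `s`: the invariant of the backward recursion. -/
structure IsValueFamilyOn (P : ℝ → Matrix (Fin n) (Fin n) ℝ) (s : Set ℝ) : Prop where
  nonneg : ∀ lam ∈ s, 0 ≤ P lam
  antitoneOn : AntitoneOn P s
  continuousOn : ContinuousOn P s

namespace IsValueFamilyOn

variable {P : ℝ → Matrix (Fin n) (Fin n) ℝ} {s t : Set ℝ}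

lemma mono (h : IsValueFamilyOn P t) (hst : s ⊆ t) : IsValueFamilyOn P s where
  nonneg lam hlam := h.nonneg lam (hst hlam)
  antitoneOn := h.antitoneOn.mono hst
  continuousOn := h.continuousOn.mono hst

lemma antitoneOn_twoNorm (h : IsValueFamilyOn P s) (G : Matrix (Fin n) (Fin q) ℝ) :
    AntitoneOn (fun lam => twoNorm (Gᵀ * P lam * G)) s := fun _ hlam mu hmu hle =>
  twoNorm_mono (transpose_mul_mul_nonneg (h.nonneg mu hmu) G)
    (transpose_mul_mul_mono (h.antitoneOn hlam hmu hle) G)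

lemma continuousOn_twoNorm (h : IsValueFamilyOn P s) (G : Matrix (Fin n) (Fin q) ℝ) :
    ContinuousOn (fun lam => twoNorm (Gᵀ * P lam * G)) s := by
  have hcont : Continuous fun X : Matrix (Fin n) (Fin n) ℝ => twoNorm (Gᵀ * X * G) :=
    continuous_twoNorm.comp (by fun_prop)
  exact hcont.comp_continuousOn h.continuousOn

lemma riccatiStep {S : Plant n m q} (h : IsValueFamilyOn P s) (hQ : 0 ≤ S.Q) (hR : S.R.PosDef)
    (hrange : LinearMap.range S.G.mulVecLin ≤ LinearMap.range S.B.mulVecLin)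
    (hs : ∀ lam ∈ s, 0 < lam) (hle : ∀ lam ∈ s, twoNorm (S.Gᵀ * P lam * S.G) ≤ lam) :
    IsValueFamilyOn (fun lam => riccatiStep S lam (P lam)) s := by
  have hPG (lam : ℝ) (hlam : lam ∈ s) : S.Gᵀ * P lam * S.G ≤ lam • 1 :=
    (twoNorm_le_iff (transpose_mul_mul_nonneg (h.nonneg lam hlam) S.G) (hs lam hlam).le).mp
      (hle lam hlam)
  exact
    { nonneg lam hlam :=
        riccatiStep_nonneg hQ hR hrange (hs lam hlam) (h.nonneg lam hlam) (hPG lam hlam)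
      antitoneOn lam hlam mu hmu hlm :=
        riccatiStep_mono (isSymm_of_nonneg hQ) hR hrange (hs lam hlam) hlm (h.nonneg mu hmu)
          (h.antitoneOn hlam hmu hlm) (hPG lam hlam)
      continuousOn := continuousOn_iff_continuous_domRestrict.mpr <|
        continuous_riccatiStep continuous_subtype_val
          (continuousOn_iff_continuous_domRestrict.mp h.continuousOn) fun lam =>
            isUnit_det_blockM hR hrange (hs lam lam.2) (h.nonneg lam lam.2) (hPG lam lam.2) }

end IsValueFamilyOn

lemma sInf_fixedPoints_mem {β : Type*} [ConditionallyCompleteLinearOrder β] [DenselyOrdered β]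
    [TopologicalSpace β] [OrderTopology β] {f : β → β} {b : β} (hcont : ContinuousOn f (Ici b))
    (hanti : AntitoneOn f (Ici b)) (hb : b ≤ f b) :
    sInf {x | b ≤ x ∧ x = f x} ∈ {x | b ≤ x ∧ x = f x} := by
  obtain ⟨c, hc, hfc⟩ := exists_mem_Icc_isFixedPt (hcont.mono Icc_subset_Ici_self) hb hb
    (hanti self_mem_Ici hb hb)
  exact (isClosed_Ici.isClosed_eq continuousOn_id hcont).csInf_mem ⟨c, hc.1, hfc.symm⟩
    ⟨b, fun _ hx => hx.1⟩

lemma boundToGo_succ_mem {S : Plant n m q} {j : ℕ}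
    (h : IsValueFamilyOn (fun lam => valueToGo S lam (j + 1)) (Ici (boundToGo S j))) :
    boundToGo S (j + 1) ∈
      {lam | boundToGo S j ≤ lam ∧ twoNorm (S.Gᵀ * valueToGo S lam (j + 1) * S.G) ≤ lam} := by
  rw [boundToGo]
  split_ifs with hlt
  · have hfix := sInf_fixedPoints_mem (h.continuousOn_twoNorm S.G) (h.antitoneOn_twoNorm S.G) hlt.le
    exact ⟨hfix.1, hfix.2.ge⟩
  · exact ⟨le_rfl, not_lt.mp hlt⟩

section Horizon

variable {S : Plant n m q}

lemma boundToGo_pos_and_isValueFamilyOn (hQ : 0 ≤ S.Q) (hR : S.R.PosDef) (hPf : 0 ≤ S.Pf)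
    (hrange : LinearMap.range S.G.mulVecLin ≤ LinearMap.range S.B.mulVecLin)
    (hG : S.Gᵀ * S.Pf * S.G ≠ 0) (j : ℕ) :
    0 < boundToGo S j ∧
    (∀ lam ∈ Ici (boundToGo S j), twoNorm (S.Gᵀ * valueToGo S lam j * S.G) ≤ lam) ∧
    IsValueFamilyOn (fun lam => valueToGo S lam j) (Ici (boundToGo S j)) := by
  induction j with
  | zero => exact ⟨twoNorm_pos hG, fun _ hlam => hlam, fun _ _ => hPf, antitoneOn_const,
      continuousOn_const⟩
  | succ j ih =>
    obtain ⟨hpos, hle, hfamily⟩ := ih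
    have hnext : IsValueFamilyOn (fun lam => valueToGo S lam (j + 1)) (Ici (boundToGo S j)) :=
      hfamily.riccatiStep hQ hR hrange (fun _ hlam => hpos.trans_le hlam) hle
    obtain ⟨hmono, hbound⟩ := boundToGo_succ_mem hnext
    exact ⟨hpos.trans_le hmono, fun lam hlam =>
        (hnext.antitoneOn_twoNorm S.G hmono (hmono.trans hlam) hlam).trans (hbound.trans hlam),
      hnext.mono (Ici_subset_Ici.mpr hmono)⟩

lemma antitoneOn_stagePi_zero (hQ : 0 ≤ S.Q) (hR : S.R.PosDef) (hPf : 0 ≤ S.Pf)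
    (hrange : LinearMap.range S.G.mulVecLin ≤ LinearMap.range S.B.mulVecLin)
    (hG : S.Gᵀ * S.Pf * S.G ≠ 0) {N : ℕ} (hN : 1 ≤ N) :
    AntitoneOn (stagePi S N 0) (Ici (stageBound S N 1)) := by
  obtain ⟨j, rfl⟩ := Nat.exists_eq_add_of_le' hN
  obtain ⟨hpos, hle, hfamily⟩ := boundToGo_pos_and_isValueFamilyOn hQ hR hPf hrange hG j
  exact (hfamily.riccatiStep hQ hR hrange (fun _ hlam => hpos.trans_le hlam) hle).antitoneOn

end Horizon

/-! ### The linear region -/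

section Region

variable (S : Plant n m q) (α : ℝ) {N : ℕ}

lemma regionL_eq_iInter (N : ℕ) :
    regionL S α N = ⋂ lam ∈ Ici (stageBound S N 1),
      {x | ((√α)⁻¹ • x) ⬝ᵥ (stagePi S N 0 (stageBound S N 1) - stagePi S N 0 lam) *ᵥ ((√α)⁻¹ • x)
        ≤ lam - stageBound S N 1} := by
  ext x
  simp only [regionL, isMinOn_iff, objective, mem_ofPred_eq, mem_iInter, sub_mulVec,
    dotProduct_sub]
  refine forall₂_congr fun lam _ => ?_
  constructor <;> intro h <;> linarith

lemma zero_mem_regionL : 0 ∈ regionL S α N := by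
  simp [regionL_eq_iInter]

lemma isClosed_regionL : IsClosed (regionL S α N) := by
  rw [regionL_eq_iInter]
  exact isClosed_biInter fun lam _ => isClosed_le (by fun_prop) continuous_const

variable {S}

lemma convex_regionL (hanti : AntitoneOn (stagePi S N 0) (Ici (stageBound S N 1))) :
    Convex ℝ (regionL S α N) := by
  rw [regionL_eq_iInter]
  refine convex_iInter₂ fun lam hlam => ?_
  have hgap : 0 ≤ stagePi S N 0 (stageBound S N 1) - stagePi S N 0 lam :=
    sub_nonneg.mpr (hanti self_mem_Ici hlam hlam)
  have hconv := (convexOn_dotProduct_mulVec hgap).comp_linearMap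
    (LinearMap.lsmul ℝ (Fin n → ℝ) (√α)⁻¹)
  simpa using hconv.convex_le (lam - stageBound S N 1)

end Region

end SiDAR

theorem proposition5 {n m q : ℕ} (S : SiDAR.Plant n m q)
    (hQ : S.Q.PosSemidef) (hR : S.R.PosDef) (hPf : S.Pf.PosSemidef)
    (hrange : LinearMap.range S.G.mulVecLin ≤ LinearMap.range S.B.mulVecLin)
    (hG : S.G.transpose * S.Pf * S.G ≠ 0)
    (α : ℝ) (hα : 0 < α) :
    (0 : Fin n → ℝ) ∈ SiDAR.limitRegionL S α ∧
    (SiDAR.limitRegionL S α).Nonempty ∧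
    IsClosed (SiDAR.limitRegionL S α) ∧
    Convex ℝ (SiDAR.limitRegionL S α) ∧
    IsOpen (SiDAR.limitRegionNL S α) := by
  have hzero : (0 : Fin n → ℝ) ∈ SiDAR.limitRegionL S α :=
    Set.mem_iInter₂.mpr fun N _ => SiDAR.zero_mem_regionL S α
  have hclosed : IsClosed (SiDAR.limitRegionL S α) :=
    isClosed_biInter fun N _ => SiDAR.isClosed_regionL S α
  have hconvex : Convex ℝ (SiDAR.limitRegionL S α) := convex_iInter₂ fun N hN =>
    SiDAR.convex_regionL α <| SiDAR.antitoneOn_stagePi_zero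
      (Matrix.nonneg_iff_posSemidef.mpr hQ) hR (Matrix.nonneg_iff_posSemidef.mpr hPf) hrange hG hN
  exact ⟨hzero, ⟨0, hzero⟩, hclosed, hconvex, hclosed.isOpen_compl⟩
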